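/- Let $F$ be an algebraically closed field of characteristic $0$, and let $\mathfrak g$ be a finite-dimensional Lie algebra over $F$ with $\dim\mathfrak g\le 13$. Let $B$ be a nondegenerate symmetric bilinear form on $\mathfrak g$ that is invariant, i.e. $B([x,y],z)=B(x,[y,z])$ for all $x,y,z\in\mathfrak g$. Assume that $(\mathfrak g,B)$ is irreducible, i.e. the only ideals of $\mathfrak g$ on which $B$ restricts to a nondegenerate form are $0$ and $\mathfrak g$, and that $\mathfrak g$ is neither solvable nor simple. Let $\mathfrak r$ be the solvable radical of $\mathfrak g$, let $\mathfrak s$ be a Levi subalgebra (a semisimple subalgebra with $\mathfrak g=\mathfrak s\oplus\mathfrak r$ as vector spaces), let $\mathfrak r^\perp$ be the orthogonal of $\mathfrak r$ with respect to $B$, and assume $\mathfrak r\neq\mathfrak r^\perp$. For $n\ge 0$ let $V(n)$ denote the $(n+1)$-dimensional irreducible $\mathfrak{sl}_2(F)$-module, realized as the homogeneous polynomials of degree $n$ in two variables (the $n$-th symmetric power of the natural module). Then: 1. $\mathfrak s$ is isomorphic to $\mathfrak{sl}_2(F)$. 2. $\mathfrak r^\perp\subseteq\mathfrak r$, and for every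 isomorphism $\mathfrak s\cong\mathfrak{sl}_2(F)$, every irreducible $\mathfrak s$-submodule of $\mathfrak r/\mathfrak r^\perp$ is isomorphic, as an $\mathfrak{sl}_2(F)$-module through this isomorphism, to $V(n)$ for some $n\in\{0,1,2,4,6\}$. -/

import Mathlib

namespace QuadraticLie

variable {F L : Type*} [Field F] [LieRing L] [LieAlgebra F L]

/-- An invariant scalar product on a Lie algebra: a nondegenerate, symmetric bilinear form with
`B([x,y],z) = B(x,[y,z])`. -/
structure IsInvariantScalarProduct (B : LinearMap.BilinForm F L) : Prop where
  nondegenerate : B.Nondegenerate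
  symm : ∀ x y : L, B x y = B y x
  invariant : ∀ x y z : L, B ⁅x, y⁆ z = B x ⁅y, z⁆

theorem IsInvariantScalarProduct.lieInvariant {B : LinearMap.BilinForm F L}
    (hB : IsInvariantScalarProduct B) : B.lieInvariant L := by
  intro x y z
  rw [← hB.invariant y x z, ← lie_skew x y, map_neg, LinearMap.neg_apply]

/-- The ideal `I^⊥` of the elements that are `B`-orthogonal to the ideal `I`. -/
def orthogonalIdeal {B : LinearMap.BilinForm F L} (hB : IsInvariantScalarProduct B)
    (I : LieIdeal F L) : LieIdeal F L :=
  LieAlgebra.InvariantForm.orthogonal B hB.lieInvariant I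

/-- The Lie algebra is `B`-irreducible: its only ideals on which `B` restricts to a nondegenerate
form are the trivial ones, `0` and the whole algebra. -/
def IsIrreducibleForm (B : LinearMap.BilinForm F L) : Prop :=
  ∀ I : LieIdeal F L, (B.restrict I.toSubmodule).Nondegenerate → I = ⊥ ∨ I = ⊤

variable (F L) in
/-- A Levi subalgebra: a semisimple subalgebra that complements the solvable radical. -/
structure IsLeviSubalgebra (s : LieSubalgebra F L) : Prop where
  semisimple : LieAlgebra.IsSemisimple F s
  isCompl : IsCompl s.toSubmodule (LieAlgebra.radical F L).toSubmodule

/-- The quotient `I/J` of an ideal `I` by an ideal `J` (used for `J ≤ I`), which is a Lie module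
for the whole Lie algebra, hence for each of its subalgebras. -/
abbrev IdealQuotient (I J : LieIdeal F L) : Type _ :=
  I ⧸ (LieSubmodule.comap (LieSubmodule.incl I) J : LieSubmodule F L I)

end QuadraticLie

namespace SL2

open MvPolynomial

attribute [local instance 100] LieRing.ofAssociativeRing

/-- The Lie algebra `sl₂(F)` of traceless `2 × 2` matrices. -/
abbrev sl2 (F : Type*) [Field F] : LieSubalgebra F (Matrix (Fin 2) (Fin 2) F) :=
  LieAlgebra.SpecialLinear.sl (Fin 2) F

/-- The derivation of `F[X₀, X₁]` extending the action of the matrix `A` on the natural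
two-dimensional module with basis `X₀, X₁`. -/
noncomputable def matrixDerivation {F : Type*} [Field F] (A : Matrix (Fin 2) (Fin 2) F) :
    Derivation F (MvPolynomial (Fin 2) F) (MvPolynomial (Fin 2) F) :=
  mkDerivation F (fun j => ∑ i, A i j • X i)

theorem matrixDerivation_X {F : Type*} [Field F] (A : Matrix (Fin 2) (Fin 2) F) (j : Fin 2) :
    matrixDerivation A (X j) = ∑ i, A i j • X i := by
  simp [matrixDerivation]

theorem matrixDerivation_lie {F : Type*} [Field F] (A B : Matrix (Fin 2) (Fin 2) F) :
    matrixDerivation ⁅A, B⁆ = ⁅matrixDerivation A, matrixDerivation B⁆ := by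
  ext1 j
  rw [Derivation.commutator_apply, matrixDerivation_X, matrixDerivation_X, matrixDerivation_X]
  simp only [Ring.lie_def, Matrix.sub_apply, Matrix.mul_apply, Fin.sum_univ_two, map_add,
    Derivation.map_smul, matrixDerivation_X]
  module

theorem matrixDerivation_apply {F : Type*} [Field F] (A : Matrix (Fin 2) (Fin 2) F)
    (p : MvPolynomial (Fin 2) F) :
    matrixDerivation A p = ∑ j, ∑ i, A i j • (X i * pderiv j p) := by
  have h : matrixDerivation A =
      ∑ j, ∑ i, A i j • ((X i : MvPolynomial (Fin 2) F) • pderiv (R := F) j) := by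
    ext1 k
    rw [matrixDerivation_X]
    fin_cases k <;> simp [Fin.sum_univ_two, pderiv_X]
  rw [h]
  simp [Fin.sum_univ_two]

theorem matrixDerivation_mem {F : Type*} [Field F] (n : ℕ) (A : Matrix (Fin 2) (Fin 2) F)
    (p : MvPolynomial (Fin 2) F) (hp : p ∈ homogeneousSubmodule (Fin 2) F n) :
    matrixDerivation A p ∈ homogeneousSubmodule (Fin 2) F n := by
  rw [matrixDerivation_apply]
  refine Submodule.sum_mem _ fun j _ => Submodule.sum_mem _ fun i _ => Submodule.smul_mem _ _ ?_
  rw [mem_homogeneousSubmodule] at hp ⊢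
  rcases n with _ | n
  · rw [← totalDegree_zero_iff_isHomogeneous, totalDegree_eq_zero_iff_eq_C] at hp
    rw [hp, pderiv_C, mul_zero]
    exact isHomogeneous_zero _ _ _
  · have h := (isHomogeneous_X F i).mul (hp.pderiv (i := j))
    rwa [Nat.add_sub_cancel, add_comm] at h

/-- The `sl₂(F)`-module `V(n)`: the space of homogeneous polynomials of degree `n` in `X₀, X₁`,
that is, the `n`-th symmetric power of the natural module; its dimension is `n + 1`. -/
def V (F : Type*) [Field F] (n : ℕ) : Type _ := homogeneousSubmodule (Fin 2) F n

noncomputable instance V.addCommGroup (F : Type*) [Field F] (n : ℕ) : AddCommGroup (V F n) :=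
  inferInstanceAs (AddCommGroup (homogeneousSubmodule (Fin 2) F n))

noncomputable instance V.module (F : Type*) [Field F] (n : ℕ) : Module F (V F n) :=
  inferInstanceAs (Module F (homogeneousSubmodule (Fin 2) F n))

/-- The representation of `sl₂(F)` on `V(n)`. -/
noncomputable def V.rep (F : Type*) [Field F] (n : ℕ) : sl2 F →ₗ⁅F⁆ Module.End F (V F n) where
  toFun A := (matrixDerivation (A : Matrix (Fin 2) (Fin 2) F)).toLinearMap.restrict
    (p := homogeneousSubmodule (Fin 2) F n) (q := homogeneousSubmodule (Fin 2) F n)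
    (matrixDerivation_mem n _)
  map_add' A B := by
    ext1 p
    refine Subtype.ext ?_
    change matrixDerivation (A.1 + B.1) p.1 = matrixDerivation A.1 p.1 + matrixDerivation B.1 p.1
    simp only [matrixDerivation_apply, Matrix.add_apply, add_smul, Finset.sum_add_distrib]
  map_smul' c A := by
    ext1 p
    refine Subtype.ext ?_
    change matrixDerivation (c • A.1) p.1 = c • matrixDerivation A.1 p.1
    simp only [matrixDerivation_apply, Matrix.smul_apply, smul_assoc, Finset.smul_sum]
  map_lie' {A B} := by
    ext1 p
    refine Subtype.ext ?_
    change matrixDerivation ⁅A.1, B.1⁆ p.1 =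
      matrixDerivation A.1 (matrixDerivation B.1 p.1) -
        matrixDerivation B.1 (matrixDerivation A.1 p.1)
    rw [matrixDerivation_lie, Derivation.commutator_apply]

noncomputable instance V.lieRingModule (F : Type*) [Field F] (n : ℕ) : LieRingModule (sl2 F) (V F n) :=
  LieRingModule.compLieHom (V F n) (V.rep F n)

instance V.lieModule (F : Type*) [Field F] (n : ℕ) : LieModule F (sl2 F) (V F n) :=
  LieModule.compLieHom (V F n) (V.rep F n)

end SL2

/-!
Write `r` for the radical and `W = r/r^⊥`.

*The orthogonal of the radical lies in the radical.* The quotient `L/r` is isomorphic to the Levi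
subalgebra, so its Killing form is nondegenerate and the image of `r^⊥` in it has a complementary
ideal. The orthogonal of the preimage of that complement meets `r` trivially. An ideal that meets
`r` trivially is nondegenerate, because its intersection with its orthogonal is abelian; by
irreducibility it is `0` or everything. The first case says `r^⊥ ≤ r`; in the second the radical
vanishes and every ideal is nondegenerate, so that `L` is simple
(`QuadraticLie.orthogonalIdeal_radical_le`).

*The Levi subalgebra.* Since `dim r^⊥ = dim L - dim r = dim s`, one has `2 dim s + dim W ≤ 13` with
`W ≠ 0`. Moreover `dim W ≠ 1`: on a line `W` the algebra `L` would act by zero, and a generator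
of `W` would lift to a central anisotropic vector, which spans a nondegenerate ideal
(`QuadraticLie.finrank_radical_ne_add_one`).
Hence `dim s ≤ 5`. A semisimple algebra with two nonproportional roots has dimension at least six,
so `s` has rank one and is spanned by the `sl₂`-triple of a root
(`LieAlgebra.IsKilling.exists_isSl2Triple_spanning`).

*The irreducible submodules of `W`.* Now `dim s = 3` and `dim W ≤ 7`. An irreducible submodule is
generated by a primitive vector of some weight `n ≤ 6`, and matching weight bases identifies it with
`V(n)` (`SL2.exists_linearEquiv_V`). The form of `L` induces a nondegenerate invariant symmetric form
on `W`. For odd `n` it vanishes on the submodule, because an invariant form on `V(n)` is then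
alternating; a totally isotropic subspace has dimension at most `dim W / 2`, so `2(n + 1) ≤ 7`, which
excludes `n = 3` and `n = 5` (`IsSl2Triple.HasPrimitiveVectorWith.two_mul_le_finrank`).
-/

/-! ### Semisimple Lie algebras of dimension at most five -/

namespace LieAlgebra.IsKilling

open LieModule Module

variable {K L : Type*} [Field K] [CharZero K] [LieRing L] [LieAlgebra K L]
  [FiniteDimensional K L] [IsKilling K L]

/-- Two roots that are not proportional need a Cartan subalgebra of dimension at least two and
four root spaces, hence an algebra of dimension at least six. -/
lemma six_le_finrank_of_ne_of_ne_neg (H : LieSubalgebra K L) [H.IsCartanSubalgebra]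
    [IsTriangularizable K H L] {α β : Weight K H L} (hα : α.IsNonZero) (hβ : β.IsNonZero)
    (h₁ : β ≠ α) (h₂ : β ≠ -α) : 6 ≤ finrank K L := by
  have hli : LinearIndependent K ![α.toLinear, β.toLinear] := by
    rw [LinearIndependent.pair_iff' (by simpa using hα)]
    intro a ha
    have : (β : H → K) = a • α := by
      ext x
      exact (LinearMap.congr_fun ha x).symm
    rcases eq_neg_or_eq_of_eq_smul α β hβ a this with h | h
    exacts [h₂ h, h₁ h]
  have hH : 2 ≤ finrank K H := by
    rw [← Subspace.dual_finrank_eq]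
    simpa using hli.fintype_card_le_finrank
  have hne (γ : Weight K H L) (hγ : γ.IsNonZero) : γ ≠ -γ := by
    intro h
    apply hγ
    ext x
    have h' : γ x = -γ x := by
      conv_lhs => rw [h]
      rfl
    simpa [self_eq_neg] using h'
  have hnz : ∀ (γ : Weight K H L), γ.IsNonZero → (0 : H → K) ≠ γ := fun γ hγ h => hγ h.symm
  have hinj : ∀ {γ δ : Weight K H L}, γ ≠ δ → (γ : H → K) ≠ δ :=
    fun h h' => h (DFunLike.coe_injective h')
  have h₃ : -β ≠ α := fun h => h₂ (by rw [← h, neg_neg])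
  have h₄ : -β ≠ -α := fun h => h₁ (neg_injective h)
  let w : Fin 5 → H → K := ![0, α, (-α : Weight K H L), β, (-β : Weight K H L)]
  have hw : Function.Injective w := by
    have e₀ := hnz α hα
    have e₁ := hnz (-α) (by simpa using hα)
    have e₂ := hnz β hβ
    have e₃ := hnz (-β) (by simpa using hβ)
    have e₄ := hinj (hne α hα)
    have e₅ := hinj (hne β hβ)
    have e₆ := hinj h₁
    have e₇ := hinj h₂
    have e₈ := hinj h₃
    have e₉ := hinj h₄
    intro i j hij
    fin_cases i <;> fin_cases j <;>
      first
      | rfl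
      | exact absurd hij ‹_›
      | exact absurd hij.symm ‹_›
  have hind : iSupIndep fun i => (rootSpace H (w i)).toSubmodule :=
    LieSubmodule.iSupIndep_toSubmodule.mpr ((iSupIndep_genWeightSpace K H L).comp hw)
  have hle := LinearMap.finrank_le_finrank_of_injective hind.dfinsupp_lsum_injective
  have hsum : finrank K (Π₀ i, (rootSpace H (w i)).toSubmodule) =
      ∑ i, finrank K (rootSpace H (w i)) :=
    finrank_directSum (R := K) fun i => (rootSpace H (w i)).toSubmodule
  rw [hsum] at hle
  have r₀ : 2 ≤ finrank K (rootSpace H (w 0)) := by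
    change 2 ≤ finrank K (rootSpace H (0 : H → K))
    rw [rootSpace_zero_eq]
    exact hH
  have r₁ : finrank K (rootSpace H (w 1)) = 1 := finrank_rootSpace_eq_one α hα
  have r₂ : finrank K (rootSpace H (w 2)) = 1 :=
    finrank_rootSpace_eq_one (-α) (by simpa using hα)
  have r₃ : finrank K (rootSpace H (w 3)) = 1 := finrank_rootSpace_eq_one β hβ
  have r₄ : finrank K (rootSpace H (w 4)) = 1 :=
    finrank_rootSpace_eq_one (-β) (by simpa using hβ)
  rw [Fin.sum_univ_five] at hle
  lia

/-- A nonzero semisimple Lie algebra of dimension at most five has rank one, so that it is spanned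
by the `sl₂`-triple of a root. -/
theorem exists_isSl2Triple_spanning [IsAlgClosed K] [Nontrivial L] (hL : finrank K L ≤ 5) :
    ∃ h e f : L, IsSl2Triple h e f ∧ ∀ x : L, ∃ a b c : K, x = a • e + b • f + c • h := by
  obtain ⟨x₀, hx₀⟩ := exists_isCartanSubalgebra_engel K L
  set H := LieSubalgebra.engel K x₀
  have htop := cartan_sup_iSup_rootSpace_eq_top (K := K) (L := L) (H := H)
  rw [← biSup_corootSubmodule_eq_cartan] at htop
  obtain ⟨α, hα⟩ : ∃ α : Weight K H L, α.IsNonZero := by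
    by_contra! hno
    have hbot : (⊤ : LieSubmodule K H L) = ⊥ := by
      rw [← htop]
      simp [hno]
    exact top_ne_bot hbot
  have hall : ∀ β : Weight K H L, β.IsNonZero → β = α ∨ β = -α := by
    intro β hβ
    by_contra! hne
    have := six_le_finrank_of_ne_of_ne_neg H hα hβ hne.1 hne.2
    lia
  have hneg : corootSpace (-α : Weight K H L) ≤ corootSpace (α : H → K) := by
    rw [← LieSubmodule.toSubmodule_le_toSubmodule, coe_corootSpace_eq_span_singleton,
      coe_corootSpace_eq_span_singleton, coroot_neg, Submodule.span_singleton_le_iff_mem]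
    exact Submodule.neg_mem _ (Submodule.mem_span_singleton_self _)
  have hle : (⊤ : LieSubmodule K H L) ≤ sl2SubmoduleOfRoot hα := by
    rw [← htop, sl2SubmoduleOfRoot_eq_sup]
    refine sup_le (iSup₂_le fun β hβ => ?_) (iSup₂_le fun β hβ => ?_)
    · rcases hall β hβ with rfl | rfl
      · exact le_sup_right
      · exact (LieSubmodule.map_mono hneg).trans le_sup_right
    · rcases hall β hβ with rfl | rfl
      · exact le_sup_left.trans le_sup_left
      · exact le_sup_right.trans le_sup_left
  obtain ⟨h, e, f, ht, he, hf⟩ := exists_isSl2Triple_of_weight_isNonZero hα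
  refine ⟨h, e, f, ht, fun x => ?_⟩
  have hx : x ∈ sl2SubalgebraOfRoot hα := hle (LieSubmodule.mem_top x)
  obtain ⟨a, b, c, rfl⟩ := (mem_sl2SubalgebraOfRoot_iff hα ht he hf).mp hx
  exact ⟨a, b, c, by rw [ht.lie_e_f]⟩

end LieAlgebra.IsKilling

/-! ### The Lie algebra `sl₂(F)` and `sl₂`-triples -/

namespace SL2

open Matrix

attribute [local instance 100] LieRing.ofAssociativeRing

variable {F : Type*} [Field F]

/-- The matrix `[[c, a], [b, -c]]` of `sl₂(F)`. -/
def ofCoords (a b c : F) : sl2 F :=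
  ⟨!![c, a; b, -c], by simp [sl2, LieAlgebra.SpecialLinear.sl, Matrix.trace_fin_two]⟩

lemma coe_ofCoords (a b c : F) : (ofCoords a b c : Matrix (Fin 2) (Fin 2) F) = !![c, a; b, -c] :=
  rfl

lemma apply_one_one (A : sl2 F) : (A : Matrix (Fin 2) (Fin 2) F) 1 1 = -A.1 0 0 := by
  have h : A.1 0 0 + A.1 1 1 = 0 := by
    have := A.2
    rw [← Matrix.trace_fin_two]
    exact this
  linear_combination h

lemma eq_ofCoords (A : sl2 F) : A = ofCoords (A.1 0 1) (A.1 1 0) (A.1 0 0) := by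
  refine Subtype.ext ?_
  ext i j
  fin_cases i <;> fin_cases j <;> simp [coe_ofCoords, apply_one_one]

lemma ofCoords_eq_add (a b c : F) :
    ofCoords a b c = a • ofCoords 1 0 0 + b • ofCoords 0 1 0 + c • ofCoords 0 0 1 := by
  refine Subtype.ext ?_
  change _ = a • (ofCoords 1 0 0 : sl2 F).1 + b • (ofCoords 0 1 0 : sl2 F).1
    + c • (ofCoords 0 0 1 : sl2 F).1
  ext i j
  fin_cases i <;> fin_cases j <;> simp [coe_ofCoords]

lemma lie_ofCoords (a b c a' b' c' : F) :
    ⁅ofCoords a b c, ofCoords a' b' c'⁆ =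
      ofCoords (2 * (c * a' - a * c')) (2 * (b * c' - c * b')) (a * b' - b * a') := by
  refine Subtype.ext ?_
  rw [LieAlgebra.SpecialLinear.sl_bracket]
  ext i j
  fin_cases i <;> fin_cases j <;> simp [coe_ofCoords] <;> ring

/-- The standard `sl₂`-triple of `sl₂(F)`. -/
lemma isSl2Triple_ofCoords :
    IsSl2Triple (ofCoords 0 0 1 : sl2 F) (ofCoords 1 0 0) (ofCoords 0 1 0) where
  h_ne_zero h := by
    have := congrArg (fun A : sl2 F => A.1 0 0) h
    simp [coe_ofCoords] at this
  lie_e_f := by rw [lie_ofCoords]; norm_num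
  lie_h_e_nsmul := by
    rw [lie_ofCoords, ofCoords_eq_add]; module
  lie_h_f_nsmul := by
    rw [lie_ofCoords, ofCoords_eq_add]; module

lemma finrank_sl2 : Module.finrank F (sl2 F) = 3 := by
  let T : sl2 F ≃ₗ[F] Fin 3 → F :=
    { toFun := fun A => ![A.1 0 1, A.1 1 0, A.1 0 0]
      map_add' := fun A B => by
        ext i
        fin_cases i <;> rfl
      map_smul' := fun k A => by
        ext i
        fin_cases i <;> rfl
      invFun := fun v => ofCoords (v 0) (v 1) (v 2)
      left_inv := fun A => (eq_ofCoords A).symm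
      right_inv := fun v => by
        ext i
        fin_cases i <;> rfl }
  simpa using T.finrank_eq

variable [CharZero F] {S : Type*} [LieRing S] [LieAlgebra F S]

/-- A Lie algebra spanned by an `sl₂`-triple is isomorphic to `sl₂(F)`. -/
theorem nonempty_lieEquiv_of_spanning {h e f : S} (t : IsSl2Triple h e f)
    (hspan : ∀ x : S, ∃ a b c : F, x = a • e + b • f + c • h) :
    Nonempty (S ≃ₗ⁅F⁆ sl2 F) := by
  have he : ⁅h, e⁆ = (2 : F) • e := t.lie_h_e_smul F
  have hf : ⁅h, f⁆ = -((2 : F) • f) := t.lie_lie_smul_f F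
  have hef : ⁅e, f⁆ = h := t.lie_e_f
  have eh : ⁅e, h⁆ = -((2 : F) • e) := by rw [← lie_skew, he]
  have fh : ⁅f, h⁆ = (2 : F) • f := by rw [← lie_skew, hf, neg_neg]
  have fe : ⁅f, e⁆ = -h := by rw [← lie_skew, hef]
  let T : sl2 F →ₗ⁅F⁆ S :=
    { toFun := fun A => A.1 0 1 • e + A.1 1 0 • f + A.1 0 0 • h
      map_add' := fun A B => by
        change (A.1 0 1 + B.1 0 1) • e + (A.1 1 0 + B.1 1 0) • f + (A.1 0 0 + B.1 0 0) • h = _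
        module
      map_smul' := fun k A => by
        change (k * A.1 0 1) • e + (k * A.1 1 0) • f + (k * A.1 0 0) • h = k • _
        module
      map_lie' := fun {A B} => by
        obtain ⟨a, b, c, rfl⟩ : ∃ a b c, A = ofCoords a b c := ⟨_, _, _, eq_ofCoords A⟩
        obtain ⟨a', b', c', rfl⟩ : ∃ a b c, B = ofCoords a b c := ⟨_, _, _, eq_ofCoords B⟩
        rw [lie_ofCoords]
        change (2 * (c * a' - a * c')) • e + (2 * (b * c' - c * b')) • f + (a * b' - b * a') • h =
          ⁅a • e + b • f + c • h, a' • e + b' • f + c' • h⁆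
        simp only [lie_add, add_lie, lie_smul, smul_lie, lie_self, he, hf, hef, eh, fh, fe]
        module }
  have hT : Function.Bijective T := by
    constructor
    · rw [← LieHom.coe_toLinearMap, ← LinearMap.ker_eq_bot, LinearMap.ker_eq_bot']
      intro A hA
      have h₀ : A.1 0 1 • e + A.1 1 0 • f + A.1 0 0 • h = 0 := hA
      rw [eq_ofCoords A]
      generalize A.1 0 1 = a at h₀ ⊢
      generalize A.1 1 0 = b at h₀ ⊢
      generalize A.1 0 0 = c at h₀ ⊢
      -- `ad h` has the eigenvalues `2`, `-2`, `0` on `e`, `f`, `h`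
      have h₁ := congrArg (fun x => ⁅h, x⁆) h₀
      have h₂ := congrArg (fun x => ⁅h, ⁅h, x⁆⁆) h₀
      simp only [lie_add, lie_smul, lie_neg, lie_self, he, hf, lie_zero] at h₁ h₂
      have ha : (8 * a) • e = 0 := by
        linear_combination (norm := module) (2 : F) • h₁ + h₂
      have hb : (8 * b) • f = 0 := by
        linear_combination (norm := module) -(2 : F) • h₁ + h₂
      have ha' : a = 0 := by simpa [t.e_ne_zero] using ha
      have hb' : b = 0 := by simpa [t.f_ne_zero] using hb
      subst ha' hb'
      have hc' : c = 0 := by simpa [t.h_ne_zero] using h₀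
      subst hc'
      refine Subtype.ext ?_
      ext i j
      fin_cases i <;> fin_cases j <;> simp [coe_ofCoords]
    · intro x
      obtain ⟨a, b, c, rfl⟩ := hspan x
      exact ⟨ofCoords a b c, rfl⟩
  exact ⟨(LieEquiv.ofBijective T hT).symm⟩

end SL2

/-! ### Irreducible modules generated by a primitive vector -/

namespace IsSl2Triple

open Module LieModule

variable {K S M : Type*} [Field K] [CharZero K] [LieRing S] [LieAlgebra K S]
  [AddCommGroup M] [Module K M] [LieRingModule S M] [LieModule K S M]
  {h e f : S} {t : IsSl2Triple h e f} {m : M} {n : ℕ}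

/-- The vectors `fⁱ m`, for a primitive vector `m` of weight `n` and `i ≤ n`, have pairwise
distinct weights. -/
lemma HasPrimitiveVectorWith.linearIndependent_pow_toEnd_f
    (P : t.HasPrimitiveVectorWith m (n : K)) :
    LinearIndependent K fun i : Fin (n + 1) => (toEnd K S M f ^ (i : ℕ)) m := by
  refine (toEnd K S M h).eigenvectors_linearIndependent'
    (fun i : Fin (n + 1) => (n : K) - 2 * (i : ℕ)) (fun i j hij => ?_) _ fun i => ?_
  · simpa [Fin.ext_iff] using hij
  · refine Module.End.hasEigenvector_iff.mpr ⟨Module.End.mem_eigenspace_iff.mpr ?_, ?_⟩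
    · exact P.lie_h_pow_toEnd_f i
    · exact P.pow_toEnd_f_ne_zero_of_eq_nat rfl (Nat.lt_succ_iff.mp i.2)

/-- A primitive vector of an irreducible module generates it under `f`. -/
lemma HasPrimitiveVectorWith.span_pow_toEnd_f_eq_top [FiniteDimensional K M] [IsIrreducible K S M]
    (hspan : ∀ x : S, ∃ a b c : K, x = a • e + b • f + c • h)
    (P : t.HasPrimitiveVectorWith m (n : K)) :
    Submodule.span K (Set.range fun i : Fin (n + 1) => (toEnd K S M f ^ (i : ℕ)) m) = ⊤ := by
  set N := Submodule.span K (Set.range fun i : Fin (n + 1) => (toEnd K S M f ^ (i : ℕ)) m)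
  have hmem (i : ℕ) (hi : i ≤ n) : (toEnd K S M f ^ i) m ∈ N :=
    Submodule.subset_span ⟨⟨i, Nat.lt_succ_iff.mpr hi⟩, rfl⟩
  have hmem' (i : ℕ) : (toEnd K S M f ^ i) m ∈ N := by
    rcases le_or_gt i n with hi | hi
    · exact hmem i hi
    · obtain ⟨k, rfl⟩ := Nat.exists_eq_add_of_lt hi
      rw [show n + k + 1 = k + (n + 1) by ring, pow_add, Module.End.mul_apply,
        P.pow_toEnd_f_eq_zero_of_eq_nat rfl, map_zero]
      exact N.zero_mem
  have hstable (x : S) : N ≤ N.comap (toEnd K S M x) := by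
    refine Submodule.span_le.mpr ?_
    rintro _ ⟨i, rfl⟩
    obtain ⟨a, b, c, rfl⟩ := hspan x
    change ⁅a • e + b • f + c • h, (toEnd K S M f ^ (i : ℕ)) m⁆ ∈ N
    rw [add_lie, add_lie, smul_lie, smul_lie, smul_lie]
    refine N.add_mem (N.add_mem (N.smul_mem _ ?_) (N.smul_mem _ ?_)) (N.smul_mem _ ?_)
    · rcases i with ⟨_ | i, hi⟩
      · simp [P.lie_e]
      · rw [P.lie_e_pow_succ_toEnd_f]
        exact N.smul_mem _ (hmem' i)
    · rw [P.lie_f_pow_toEnd_f]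
      exact hmem' _
    · rw [P.lie_h_pow_toEnd_f]
      exact N.smul_mem _ (hmem' i)
  let N' : LieSubmodule K S M := { N with lie_mem := fun {x y} hy => hstable x hy }
  have hN' : N' = ⊤ := by
    refine (eq_bot_or_eq_top N').resolve_left fun hbot => P.ne_zero ?_
    have : m ∈ N' := hmem 0 (Nat.zero_le n)
    simpa [hbot] using this
  exact congrArg LieSubmodule.toSubmodule hN'

variable (n) in
/-- The weight basis of an irreducible module generated by a primitive vector of weight `n`. -/
noncomputable def HasPrimitiveVectorWith.basis [FiniteDimensional K M] [IsIrreducible K S M]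
    (hspan : ∀ x : S, ∃ a b c : K, x = a • e + b • f + c • h)
    (P : t.HasPrimitiveVectorWith m (n : K)) : Basis (Fin (n + 1)) K M :=
  .mk P.linearIndependent_pow_toEnd_f (P.span_pow_toEnd_f_eq_top hspan).ge

lemma HasPrimitiveVectorWith.basis_apply [FiniteDimensional K M] [IsIrreducible K S M]
    (hspan : ∀ x : S, ∃ a b c : K, x = a • e + b • f + c • h)
    (P : t.HasPrimitiveVectorWith m (n : K)) (i : Fin (n + 1)) :
    P.basis n hspan i = (toEnd K S M f ^ (i : ℕ)) m := by
  simp [basis]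

/-- Moving `fⁿ` across an invariant form costs the sign `(-1)ⁿ`, so for `n` odd a symmetric form
vanishes on the pair `(m, fⁿ m)`. The vector `m` is orthogonal to the other `fⁱ m` by weights. -/
lemma HasPrimitiveVectorWith.apply_pow_toEnd_f_eq_zero {B : LinearMap.BilinForm K M}
    (hinv : B.lieInvariant S) (hsymm : ∀ x y, B x y = B y x)
    (P : t.HasPrimitiveVectorWith m (n : K)) (hn : Odd n) (i : ℕ) :
    B m ((toEnd K S M f ^ i) m) = 0 := by
  rcases eq_or_ne i n with rfl | hi
  · have key (j : ℕ) : ∀ y,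
        B ((toEnd K S M f ^ j) m) y = (-1) ^ j * B m ((toEnd K S M f ^ j) y) := by
      induction j with
      | zero => simp
      | succ j ih =>
        intro y
        rw [← P.lie_f_pow_toEnd_f, hinv, ih, pow_succ (toEnd K S M f) j, Module.End.mul_apply,
          toEnd_apply_apply]
        ring
    have h₁ := key i m
    rw [hsymm, hn.neg_one_pow, neg_one_mul, self_eq_neg] at h₁
    exact h₁
  · have h₁ := hinv h m ((toEnd K S M f ^ i) m)
    rw [P.lie_h_pow_toEnd_f, P.lie_h, map_smul, map_smul, LinearMap.smul_apply, smul_eq_mul,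
      smul_eq_mul] at h₁
    have h₂ : (2 * ((n : K) - i)) * B m ((toEnd K S M f ^ i) m) = 0 := by
      linear_combination h₁
    have h₃ : (n : K) - i ≠ 0 := sub_ne_zero.mpr (by exact_mod_cast hi.symm)
    simpa [h₃] using h₂

end IsSl2Triple

/-! ### The modules `V(n)` -/

namespace SL2

open MvPolynomial LieModule

attribute [local instance 100] LieRing.ofAssociativeRing

variable {F : Type*} [Field F] {n : ℕ}

/-- The underlying polynomial of an element of `V(n)`. -/
noncomputable def V.toPoly (n : ℕ) : V F n →ₗ[F] MvPolynomial (Fin 2) F :=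
  (homogeneousSubmodule (Fin 2) F n).subtype

lemma V.toPoly_injective : Function.Injective (V.toPoly (F := F) n) :=
  (homogeneousSubmodule (Fin 2) F n).injective_subtype

lemma V.isHomogeneous_toPoly (p : V F n) : (V.toPoly n p).IsHomogeneous n :=
  Subtype.property (p := (· ∈ homogeneousSubmodule (Fin 2) F n)) p

lemma V.toPoly_lie (A : sl2 F) (p : V F n) :
    V.toPoly n ⁅A, p⁆ = matrixDerivation (A : Matrix (Fin 2) (Fin 2) F) (V.toPoly n p) :=
  rfl

variable (F n) in
/-- The highest weight vector `X₀ⁿ` of `V(n)`. -/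
noncomputable def V.highest : V F n :=
  ⟨X 0 ^ n, isHomogeneous_X_pow 0 n⟩

lemma V.toPoly_highest : V.toPoly n (V.highest F n) = X 0 ^ n := rfl

lemma matrixDerivation_ofCoords_X_zero (a b c : F) :
    matrixDerivation (ofCoords a b c : Matrix (Fin 2) (Fin 2) F) (X 0) = c • X 0 + b • X 1 := by
  simp [matrixDerivation_X, coe_ofCoords]

lemma matrixDerivation_ofCoords_X_one (a b c : F) :
    matrixDerivation (ofCoords a b c : Matrix (Fin 2) (Fin 2) F) (X 1) = a • X 0 - c • X 1 := by
  simp [matrixDerivation_X, coe_ofCoords, sub_eq_add_neg]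

lemma V.hasPrimitiveVectorWith_highest [CharZero F] :
    (isSl2Triple_ofCoords (F := F)).HasPrimitiveVectorWith (V.highest F n) (n : F) where
  ne_zero h := by
    have := congrArg (V.toPoly n) h
    rw [V.toPoly_highest, map_zero] at this
    exact pow_ne_zero n (X_ne_zero 0) this
  lie_h := by
    refine V.toPoly_injective ?_
    rw [V.toPoly_lie, map_smul, V.toPoly_highest, Derivation.leibniz_pow,
      matrixDerivation_ofCoords_X_zero]
    rcases n with _ | n
    · simp
    · simp [pow_succ, MvPolynomial.smul_eq_C_mul]
  lie_e := by
    refine V.toPoly_injective ?_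
    rw [V.toPoly_lie, V.toPoly_highest, Derivation.leibniz_pow,
      matrixDerivation_ofCoords_X_zero]
    simp

lemma V.toPoly_pow_toEnd_highest (i : ℕ) :
    V.toPoly n ((toEnd F (sl2 F) (V F n) (ofCoords 0 1 0) ^ i) (V.highest F n)) =
      (n.descFactorial i : F) • (X 0 ^ (n - i) * X 1 ^ i) := by
  induction i with
  | zero => simp [V.toPoly_highest]
  | succ i ih =>
    rw [pow_succ', Module.End.mul_apply, toEnd_apply_apply, V.toPoly_lie, ih, Derivation.map_smul,
      Derivation.leibniz, Derivation.leibniz_pow, Derivation.leibniz_pow,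
      matrixDerivation_ofCoords_X_zero, matrixDerivation_ofCoords_X_one,
      Nat.descFactorial_succ, Nat.sub_sub]
    simp only [zero_smul, one_smul, zero_add, sub_zero, smul_eq_mul, Nat.cast_mul,
      MvPolynomial.smul_eq_C_mul, map_mul, map_natCast, nsmul_eq_mul]
    ring

/-- `V(n)` is spanned by the images of `X₀ⁿ` under the powers of the lowering operator, which are
nonzero multiples of the monomials. -/
lemma V.eq_top_of_pow_toEnd_highest_mem [CharZero F] (N : Submodule F (V F n))
    (h : ∀ i ≤ n, (toEnd F (sl2 F) (V F n) (ofCoords 0 1 0) ^ i) (V.highest F n) ∈ N) :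
    N = ⊤ := by
  rw [eq_top_iff]
  intro p _
  suffices hp : V.toPoly n p ∈ N.map (V.toPoly n) by
    obtain ⟨q, hq, hqp⟩ := hp
    rwa [← V.toPoly_injective hqp]
  rw [(V.toPoly n p).as_sum]
  refine Submodule.sum_mem _ fun d hd => ?_
  have hdeg : d 0 + d 1 = n := by
    have := V.isHomogeneous_toPoly p (mem_support_iff.mp hd)
    simpa [Finsupp.weight_apply, Finsupp.sum_fintype] using this
  have hle : d 1 ≤ n := by lia
  have hmon : (monomial d (1 : F)) = X 0 ^ (n - d 1) * X 1 ^ d 1 := by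
    rw [monomial_eq, Finsupp.prod_fintype _ _ (by simp), Fin.prod_univ_two, C_1, one_mul]
    congr 2
    lia
  have hmem := Submodule.mem_map_of_mem (f := V.toPoly n) (h (d 1) hle)
  rw [V.toPoly_pow_toEnd_highest, ← hmon] at hmem
  have hne : ((n.descFactorial (d 1) : ℕ) : F) ≠ 0 := by
    exact_mod_cast (Nat.descFactorial_pos.mpr hle).ne'
  have hmem' := (Submodule.smul_mem_iff _ hne).mp hmem
  rw [← mul_one (coeff d _), ← smul_eq_mul, ← smul_monomial]
  exact Submodule.smul_mem _ _ hmem'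

variable {S M : Type*} [LieRing S] [LieAlgebra F S]
  [AddCommGroup M] [Module F M] [LieRingModule S M] [LieModule F S M]

/-- The `sl₂`-triple corresponding to the standard one under an isomorphism with `sl₂(F)`. -/
lemma isSl2Triple_symm_apply (ε : S ≃ₗ⁅F⁆ sl2 F) :
    IsSl2Triple (ε.symm (ofCoords 0 0 1)) (ε.symm (ofCoords 1 0 0)) (ε.symm (ofCoords 0 1 0)) where
  h_ne_zero h := by
    refine (isSl2Triple_ofCoords (F := F)).h_ne_zero ?_
    rw [← ε.apply_symm_apply (ofCoords 0 0 1), h]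
    exact map_zero ε.toLieHom
  lie_e_f := by rw [← LieEquiv.map_lie, isSl2Triple_ofCoords.lie_e_f]
  lie_h_e_nsmul := by
    rw [← LieEquiv.map_lie, isSl2Triple_ofCoords.lie_h_e_nsmul]
    exact map_nsmul ε.symm.toLieHom 2 _
  lie_h_f_nsmul := by
    rw [← LieEquiv.map_lie, isSl2Triple_ofCoords.lie_h_f_nsmul]
    exact (map_neg ε.symm.toLieHom _).trans (congrArg _ (map_nsmul ε.symm.toLieHom 2 _))

lemma symm_apply_spanning (ε : S ≃ₗ⁅F⁆ sl2 F) (x : S) :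
    ∃ a b c : F, x = a • ε.symm (ofCoords 1 0 0) + b • ε.symm (ofCoords 0 1 0) +
      c • ε.symm (ofCoords 0 0 1) := by
  refine ⟨(ε x).1 0 1, (ε x).1 1 0, (ε x).1 0 0, ?_⟩
  have h := congrArg ε.symm.toLieHom ((eq_ofCoords (ε x)).trans (ofCoords_eq_add _ _ _))
  rw [map_add, map_add, map_smul, map_smul, map_smul] at h
  exact (ε.symm_apply_apply x).symm.trans h

/-- An irreducible module over an algebra isomorphic to `sl₂(F)` with a primitive vector of weight
`n` is isomorphic to `V(n)`: the powers of the lowering operator give matching weight bases. -/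
theorem exists_linearEquiv_V [CharZero F] [FiniteDimensional F M] [IsIrreducible F S M]
    (ε : S ≃ₗ⁅F⁆ sl2 F) {m : M}
    (P : (isSl2Triple_symm_apply ε).HasPrimitiveVectorWith m (n : F)) :
    ∃ φ : M ≃ₗ[F] V F n, ∀ (x : S) (y : M), φ ⁅x, y⁆ = ⁅ε x, φ y⁆ := by
  have hspan := symm_apply_spanning ε
  have Q := V.hasPrimitiveVectorWith_highest (F := F) (n := n)
  let b := P.basis n hspan
  let φ : M →ₗ[F] V F n := b.constr F fun i =>
    (toEnd F (sl2 F) (V F n) (ofCoords 0 1 0) ^ (i : ℕ)) (V.highest F n)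
  have hφ (i : ℕ) : φ ((toEnd F S M (ε.symm (ofCoords 0 1 0)) ^ i) m) =
      (toEnd F (sl2 F) (V F n) (ofCoords 0 1 0) ^ i) (V.highest F n) := by
    rcases Nat.lt_or_ge i (n + 1) with hi | hi
    · have h₁ : φ (b ⟨i, hi⟩) = _ := b.constr_basis F _ _
      rwa [P.basis_apply] at h₁
    · obtain ⟨k, rfl⟩ := Nat.exists_eq_add_of_le' hi
      have hz : (toEnd F (sl2 F) (V F n) (ofCoords 0 1 0) ^ (n + 1)) (V.highest F n) = 0 := by
        refine V.toPoly_injective ?_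
        rw [V.toPoly_pow_toEnd_highest]
        simp
      rw [pow_add, Module.End.mul_apply, P.pow_toEnd_f_eq_zero_of_eq_nat rfl, map_zero, map_zero,
        pow_add, Module.End.mul_apply, hz, map_zero]
  -- equivariance is tested on the triple and on the weight basis
  have hext (x : S) (h : ∀ i : ℕ, φ ⁅x, (toEnd F S M (ε.symm (ofCoords 0 1 0)) ^ i) m⁆ =
      ⁅ε x, φ ((toEnd F S M (ε.symm (ofCoords 0 1 0)) ^ i) m)⁆) (y : M) :
      φ ⁅x, y⁆ = ⁅ε x, φ y⁆ := by
    have : φ ∘ₗ toEnd F S M x = toEnd F (sl2 F) (V F n) (ε x) ∘ₗ φ := by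
      refine b.ext fun i => ?_
      rw [P.basis_apply]
      exact h i
    exact LinearMap.congr_fun this y
  have he := hext (ε.symm (ofCoords 1 0 0)) fun i => by
    rw [ε.apply_symm_apply, hφ]
    rcases i with _ | i
    · simp [P.lie_e, Q.lie_e]
    · rw [P.lie_e_pow_succ_toEnd_f, Q.lie_e_pow_succ_toEnd_f, map_smul, hφ]
  have hf := hext (ε.symm (ofCoords 0 1 0)) fun i => by
    rw [ε.apply_symm_apply, hφ, P.lie_f_pow_toEnd_f, Q.lie_f_pow_toEnd_f, hφ]
  have hh := hext (ε.symm (ofCoords 0 0 1)) fun i => by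
    rw [ε.apply_symm_apply, hφ, P.lie_h_pow_toEnd_f, Q.lie_h_pow_toEnd_f, map_smul, hφ]
  have hequiv (x : S) (y : M) : φ ⁅x, y⁆ = ⁅ε x, φ y⁆ := by
    obtain ⟨a, b, c, rfl⟩ := hspan x
    have h₁ : ε (a • ε.symm (ofCoords 1 0 0) + b • ε.symm (ofCoords 0 1 0) +
        c • ε.symm (ofCoords 0 0 1)) = a • ε (ε.symm (ofCoords 1 0 0)) +
        b • ε (ε.symm (ofCoords 0 1 0)) + c • ε (ε.symm (ofCoords 0 0 1)) := by
      change ε.toLieHom _ = a • ε.toLieHom _ + b • ε.toLieHom _ + c • ε.toLieHom _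
      rw [map_add, map_add, map_smul, map_smul, map_smul]
    rw [h₁]
    simp only [add_lie, smul_lie, map_add, map_smul, he, hf, hh]
  have hsurj : Function.Surjective φ := by
    rw [← LinearMap.range_eq_top]
    exact V.eq_top_of_pow_toEnd_highest_mem _ fun i _ => ⟨_, hφ i⟩
  have hinj : Function.Injective φ := by
    rw [← LinearMap.ker_eq_bot]
    let N : LieSubmodule F S M :=
      { LinearMap.ker φ with
        lie_mem := fun {x y} hy => by
          change φ ⁅x, y⁆ = 0
          have hy' : φ y = 0 := hy
          rw [hequiv, hy', lie_zero] }
    have hN : N = ⊥ := by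
      refine (eq_bot_or_eq_top N).resolve_right fun htop => Q.ne_zero ?_
      have : m ∈ N := htop ▸ LieSubmodule.mem_top m
      have hm : φ m = 0 := this
      simpa using (hφ 0).symm.trans hm
    exact congrArg LieSubmodule.toSubmodule hN
  exact ⟨LinearEquiv.ofBijective φ ⟨hinj, hsurj⟩, hequiv⟩

end SL2

/-! ### Invariant forms on modules and ideals -/

namespace IsSl2Triple

open Module LieModule LieAlgebra

variable {K S M : Type*} [Field K] [CharZero K] [LieRing S] [LieAlgebra K S]
  [AddCommGroup M] [Module K M] [LieRingModule S M] [LieModule K S M] [FiniteDimensional K M]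
  {h e f : S} {t : IsSl2Triple h e f} {n : ℕ}

/-- An irreducible submodule of odd highest weight is totally isotropic for every invariant
symmetric form, so it occupies at most half of the dimension if that form is nondegenerate. -/
theorem HasPrimitiveVectorWith.two_mul_le_finrank
    (hspan : ∀ x : S, ∃ a b c : K, x = a • e + b • f + c • h)
    {B : LinearMap.BilinForm K M} (hB : B.Nondegenerate) (hinv : B.lieInvariant S)
    (hsymm : ∀ x y, B x y = B y x) (u : LieSubmodule K S M) [IsIrreducible K S u] {m : u}
    (P : t.HasPrimitiveVectorWith m (n : K)) (hn : Odd n) :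
    2 * (n + 1) ≤ finrank K M := by
  have hu : finrank K u = n + 1 := by simpa using finrank_eq_card_basis (P.basis n hspan)
  let Bu : LinearMap.BilinForm K u := B.restrict u.toSubmodule
  have horth (y : u) : B (m : M) (y : M) = 0 := by
    have hz : Bu m = 0 := by
      refine (P.basis n hspan).ext fun i => ?_
      rw [P.basis_apply]
      exact P.apply_pow_toEnd_f_eq_zero (B := Bu)
        (fun x y z => hinv x y z) (fun x y => hsymm x y) hn i
    exact LinearMap.congr_fun hz y
  let N : LieSubmodule K S u := (InvariantForm.orthogonal B hinv u).comap u.incl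
  have hN : N = ⊤ := by
    refine (eq_bot_or_eq_top N).resolve_left fun hbot => P.ne_zero ?_
    have hm : m ∈ N := by
      refine (InvariantForm.mem_orthogonal B hinv u _).mpr fun x hx => ?_
      rw [hsymm]
      exact horth ⟨x, hx⟩
    simpa [hbot] using hm
  have hle : u.toSubmodule ≤ B.orthogonal u.toSubmodule := by
    intro x hx
    have hx' : (⟨x, hx⟩ : u) ∈ N := hN ▸ LieSubmodule.mem_top _
    exact hx'
  have h₁ := Submodule.finrank_mono hle
  rw [LinearMap.BilinForm.finrank_orthogonal hB] at h₁
  have h₂ : finrank K u.toSubmodule = n + 1 := hu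
  lia

end IsSl2Triple

namespace QuadraticLie

open Module LieAlgebra

variable {F L : Type*} [Field F] [LieRing L] [LieAlgebra F L]
  {B : LinearMap.BilinForm F L}

lemma mem_orthogonalIdeal (hB : IsInvariantScalarProduct B) {I : LieIdeal F L} {y : L} :
    y ∈ orthogonalIdeal hB I ↔ ∀ x ∈ I, B x y = 0 :=
  InvariantForm.mem_orthogonal B hB.lieInvariant I y

lemma IsInvariantScalarProduct.isRefl (hB : IsInvariantScalarProduct B) : B.IsRefl :=
  fun x y h => by rw [hB.symm, h]

lemma IsInvariantScalarProduct.eq_zero (hB : IsInvariantScalarProduct B) {x : L}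
    (h : ∀ y, B x y = 0) : x = 0 :=
  hB.nondegenerate.1 x h

lemma finrank_orthogonalIdeal [FiniteDimensional F L] (hB : IsInvariantScalarProduct B)
    (I : LieIdeal F L) : finrank F (orthogonalIdeal hB I) = finrank F L - finrank F I :=
  LinearMap.BilinForm.finrank_orthogonal hB.nondegenerate I.toSubmodule

/-- An invariant scalar product induces one on `I/(I ∩ I^⊥)`. -/
theorem exists_form_idealQuotient (hB : IsInvariantScalarProduct B) (I : LieIdeal F L) :
    ∃ Q : LinearMap.BilinForm F (IdealQuotient I (orthogonalIdeal hB I)),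
      Q.Nondegenerate ∧ (∀ x y, Q x y = Q y x) ∧ Q.lieInvariant L := by
  set N : LieSubmodule F L I := LieSubmodule.comap (LieSubmodule.incl I) (orthogonalIdeal hB I)
  have hN {x : I} (hx : x ∈ N) (y : I) : B x y = 0 := by
    rw [hB.symm]
    exact (mem_orthogonalIdeal hB).mp hx y y.2
  let π : I →ₗ[F] I ⧸ N := N.toSubmodule.mkQ
  have hπ : Function.Surjective π := N.toSubmodule.mkQ_surjective
  -- the form is transported along a linear section of the quotient map
  obtain ⟨σ, hσ⟩ := π.exists_rightInverse_of_surjective (LinearMap.range_eq_top.mpr hπ)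
  have hσN (x : I) : σ (π x) - x ∈ N := by
    have h₁ : π (σ (π x) - x) = 0 := by
      rw [map_sub, sub_eq_zero]
      exact LinearMap.congr_fun hσ (π x)
    exact (Submodule.Quotient.mk_eq_zero N.toSubmodule).mp h₁
  let Q : LinearMap.BilinForm F (I ⧸ N) := (B.restrict I.toSubmodule).compl₁₂ σ σ
  have hQ (x y : I) : Q (π x) (π y) = B x y := by
    have h₁ := hN (hσN x) (σ (π y))
    have h₂ := hN (hσN y) x
    have h₃ : B (x : L) (σ (π y)) - B (x : L) y = 0 := by
      rw [← map_sub, hB.symm]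
      exact h₂
    have h₄ : B (σ (π x) : L) (σ (π y)) - B (x : L) (σ (π y)) = 0 := by
      rw [← LinearMap.sub_apply, ← map_sub]
      exact h₁
    change B (σ (π x) : L) (σ (π y)) = B (x : L) y
    linear_combination h₃ + h₄
  have hsymm (x y : I ⧸ N) : Q x y = Q y x := hB.symm _ _
  refine ⟨Q, ?_, hsymm, ?_⟩
  · have hrefl : Q.IsRefl := fun x y h => by rw [hsymm, h]
    refine (LinearMap.IsRefl.nondegenerate_iff_separatingLeft hrefl).mpr fun x hx => ?_
    obtain ⟨x, rfl⟩ := hπ x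
    refine (Submodule.Quotient.mk_eq_zero N.toSubmodule).mpr ?_
    refine (mem_orthogonalIdeal hB).mpr fun y hy => ?_
    rw [hB.symm]
    exact (hQ x ⟨y, hy⟩).symm.trans (hx _)
  · intro x y z
    obtain ⟨y, rfl⟩ := hπ y
    obtain ⟨z, rfl⟩ := hπ z
    change Q (π ⁅x, y⁆) (π z) = -Q (π y) (π ⁅x, z⁆)
    rw [hQ, hQ]
    exact hB.lieInvariant x y z

/-- The form is nondegenerate on an ideal that meets the radical trivially: the intersection of the
ideal with its orthogonal is abelian. -/
lemma restrict_nondegenerate_of_disjoint_radical [FiniteDimensional F L]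
    (hB : IsInvariantScalarProduct B) {I : LieIdeal F L} (hI : Disjoint I (radical F L)) :
    (B.restrict I.toSubmodule).Nondegenerate := by
  rw [LinearMap.BilinForm.restrict_nondegenerate_iff_isCompl_orthogonal hB.isRefl,
    LinearMap.BilinForm.isCompl_orthogonal_iff_disjoint hB.isRefl]
  set N : LieIdeal F L := I ⊓ orthogonalIdeal hB I
  have hab : IsLieAbelian N := by
    rw [LieSubmodule.lie_abelian_iff_lie_self_eq_bot, LieSubmodule.lie_eq_bot_iff]
    rintro x ⟨hx, -⟩ y ⟨-, hy⟩
    refine hB.eq_zero fun z => ?_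
    rw [← lie_skew, map_neg, LinearMap.neg_apply, hB.invariant, hB.symm, neg_eq_zero]
    exact (mem_orthogonalIdeal hB).mp hy _ (lie_mem_left F L I x z hx)
  have hle : N ≤ radical F L := (LieIdeal.solvable_iff_le_radical F L N).mp inferInstance
  have hbot : N = ⊥ := le_bot_iff.mp (hI inf_le_left hle)
  rw [Submodule.disjoint_def]
  intro x hx hx'
  have : x ∈ N := ⟨hx, hx'⟩
  simpa [hbot] using this

lemma IsLeviSubalgebra.isKilling_quotient [CharZero F] [FiniteDimensional F L]
    {s : LieSubalgebra F L} (hs : IsLeviSubalgebra F L s) : IsKilling F (L ⧸ radical F L) := by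
  have := hs.semisimple
  let π : s →ₗ⁅F⁆ L ⧸ radical F L :=
    { (radical F L).toSubmodule.mkQ ∘ₗ s.toSubmodule.subtype with
      map_lie' := fun {x y} => LieSubmodule.Quotient.mk_bracket _ (x : L) (y : L) }
  have hπ : Function.Bijective π := by
    constructor
    · rw [← LieHom.coe_toLinearMap, ← LinearMap.ker_eq_bot, LinearMap.ker_eq_bot']
      intro x hx
      have h₁ : (x : L) ∈ (radical F L).toSubmodule := (Submodule.Quotient.mk_eq_zero _).mp hx
      exact Subtype.ext (Submodule.disjoint_def.mp hs.isCompl.disjoint x x.2 h₁)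
    · intro q
      obtain ⟨x, rfl⟩ := (radical F L).toSubmodule.mkQ_surjective q
      obtain ⟨y, hy, z, hz, rfl⟩ := Submodule.mem_sup.mp
        (hs.isCompl.sup_eq_top ▸ Submodule.mem_top : x ∈ s.toSubmodule ⊔ (radical F L).toSubmodule)
      refine ⟨⟨y, hy⟩, ?_⟩
      change Submodule.Quotient.mk y = Submodule.Quotient.mk (y + z)
      rw [Submodule.Quotient.eq]
      simpa using hz
  exact isKilling_of_equiv (LieEquiv.ofBijective π hπ)

end QuadraticLie

/-! ### The radical of an irreducible quadratic Lie algebra -/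

namespace QuadraticLie

open Module LieAlgebra

variable {F L : Type*} [Field F] [LieRing L] [LieAlgebra F L]
  [FiniteDimensional F L] {B : LinearMap.BilinForm F L}

/-- In an irreducible algebra that is neither solvable nor simple, the orthogonal of the radical is
contained in the radical. Modulo the radical `r`, the ideal `r^⊥` has a complementary ideal; let
`D` be the preimage of the latter. Then `D^⊥` meets `r` trivially, so it is `0` or everything, and
`D^⊥ = 0` means `r^⊥ ≤ r`. -/
theorem orthogonalIdeal_radical_le [CharZero F] (hB : IsInvariantScalarProduct B)
    (hirr : IsIrreducibleForm B) (hsolv : ¬ IsSolvable L) (hsimple : ¬ IsSimple F L)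
    {s : LieSubalgebra F L} (hs : IsLeviSubalgebra F L s) :
    orthogonalIdeal hB (radical F L) ≤ radical F L := by
  have hkill := hs.isKilling_quotient
  set r := radical F L
  set J := orthogonalIdeal hB r
  let π : L →ₗ⁅F⁆ L ⧸ r :=
    { r.toSubmodule.mkQ with map_lie' := fun {x y} => LieSubmodule.Quotient.mk_bracket _ x y }
  have hπ : Function.Surjective π := r.toSubmodule.mkQ_surjective
  have hπ₀ {x : L} : π x = 0 ↔ x ∈ r := Submodule.Quotient.mk_eq_zero _
  set J' := LieIdeal.map π J
  have hcompl := LieIdeal.isCompl_killingCompl J'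
  set D := LieIdeal.comap π J'.killingCompl
  have hsum (x : L) : ∃ d ∈ D, ∃ j ∈ J, d + j = x := by
    have hx : π x ∈ J' ⊔ J'.killingCompl := hcompl.sup_eq_top ▸ LieSubmodule.mem_top _
    obtain ⟨a, ha, b, hb, hab⟩ := LieSubmodule.mem_sup _ _ _ |>.mp hx
    obtain ⟨j, rfl⟩ := LieIdeal.mem_map_of_surjective hπ ha
    refine ⟨x - j, ?_, j, j.2, sub_add_cancel _ _⟩
    rw [LieIdeal.mem_comap, map_sub, ← hab, add_sub_cancel_left]
    exact hb
  have hdisj : Disjoint (orthogonalIdeal hB D) r := by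
    rw [← LieSubmodule.disjoint_toSubmodule, Submodule.disjoint_def]
    intro y hy hyr
    refine hB.eq_zero fun x => ?_
    obtain ⟨d, hd, j, hj, rfl⟩ := hsum x
    rw [map_add, hB.symm, (mem_orthogonalIdeal hB).mp hy d hd, (mem_orthogonalIdeal hB).mp hj y hyr,
      add_zero]
  rcases hirr _ (restrict_nondegenerate_of_disjoint_radical hB hdisj) with h | h
  · have hD : D = ⊤ := by
      have h₁ := finrank_orthogonalIdeal hB D
      have h₂ : finrank F (orthogonalIdeal hB D) = 0 := by
        rw [h]
        exact finrank_bot F L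
      have h₃ : D.toSubmodule = ⊤ := by
        refine Submodule.eq_top_of_finrank_eq (le_antisymm (Submodule.finrank_le _) ?_)
        rw [h₂, eq_comm, Nat.sub_eq_zero_iff_le] at h₁
        exact h₁
      exact LieSubmodule.toSubmodule_injective h₃
    intro y hy
    have hyD : y ∈ D := hD ▸ LieSubmodule.mem_top y
    have : π y ∈ J' ⊓ J'.killingCompl := ⟨LieIdeal.mem_map hy, LieIdeal.mem_comap.mp hyD⟩
    rw [hcompl.inf_eq_bot, LieSubmodule.mem_bot, hπ₀] at this
    exact this
  · -- the radical vanishes, so the form is nondegenerate on every ideal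
    have hr : r = ⊥ := by
      rw [h] at hdisj
      exact top_disjoint.mp hdisj
    refine absurd ⟨fun I => hirr I (restrict_nondegenerate_of_disjoint_radical hB ?_),
      fun hab => hsolv inferInstance⟩ hsimple
    change Disjoint I r
    rw [hr]
    exact disjoint_bot_right

/-- The orthogonal of the radical cannot have codimension one in the radical: a vector of the
radical outside it would then be annihilated modulo `r^⊥` by the whole algebra, and could be
corrected to a central anisotropic vector, which spans a nondegenerate ideal. -/
theorem finrank_radical_ne_add_one [NeZero (2 : F)] (hB : IsInvariantScalarProduct B)
    (hirr : IsIrreducibleForm B) (hsolv : ¬ IsSolvable L)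
    {s : LieSubalgebra F L} (hs : IsLeviSubalgebra F L s)
    (hle : orthogonalIdeal hB (radical F L) ≤ radical F L) :
    finrank F (radical F L) ≠ finrank F (orthogonalIdeal hB (radical F L)) + 1 := by
  intro hdim
  set r := radical F L
  set J := orthogonalIdeal hB r
  have hJ {j y : L} (hj : j ∈ J) (hy : y ∈ r) : B j y = 0 := by
    rw [hB.symm]
    exact (mem_orthogonalIdeal hB).mp hj y hy
  obtain ⟨v, hvr, hvJ⟩ : ∃ v ∈ r, v ∉ J := by
    by_contra! hno
    have h₁ : J = r := le_antisymm hle hno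
    rw [h₁] at hdim
    lia
  have hspan {y : L} (hy : y ∈ r) : ∃ (c : F), ∃ j ∈ J, c • v + j = y := by
    have h₁ : J.toSubmodule < F ∙ v ⊔ J.toSubmodule := by
      refine lt_of_le_of_ne le_sup_right fun h => hvJ ?_
      have : v ∈ F ∙ v ⊔ J.toSubmodule :=
        Submodule.mem_sup_left (Submodule.mem_span_singleton_self v)
      rwa [← h] at this
    have h₂ : F ∙ v ⊔ J.toSubmodule = r.toSubmodule := by
      refine Submodule.eq_of_le_of_finrank_le
        (sup_le (by simpa using hvr) hle) ?_
      have h₃ := Submodule.finrank_lt_finrank_of_lt h₁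
      have h₄ : finrank F r.toSubmodule = finrank F J.toSubmodule + 1 := hdim
      lia
    have hy' : y ∈ F ∙ v ⊔ J.toSubmodule := h₂ ▸ hy
    obtain ⟨a, ha, j, hj, rfl⟩ := Submodule.mem_sup.mp hy'
    obtain ⟨c, rfl⟩ := Submodule.mem_span_singleton.mp ha
    exact ⟨c, j, hj, rfl⟩
  have hvv : B v v ≠ 0 := by
    intro h
    refine hvJ ((mem_orthogonalIdeal hB).mpr fun y hy => ?_)
    obtain ⟨c, j, hj, rfl⟩ := hspan hy
    rw [map_add, LinearMap.add_apply, map_smul, LinearMap.smul_apply, h, hJ hj hvr, smul_zero,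
      add_zero]
  have hlie (x : L) {y : L} (hy : y ∈ r) : ⁅x, y⁆ ∈ J := by
    have hxv : B ⁅x, v⁆ v = 0 := by
      have h₁ := hB.lieInvariant x v v
      rw [hB.symm v, eq_neg_iff_add_eq_zero, ← two_mul] at h₁
      exact (mul_eq_zero.mp h₁).resolve_left two_ne_zero
    obtain ⟨c, j, hj, rfl⟩ := hspan hy
    rw [lie_add, lie_smul]
    refine J.add_mem (J.smul_mem c ?_) (J.lie_mem hj)
    refine (mem_orthogonalIdeal hB).mpr fun z hz => ?_
    obtain ⟨c', j', hj', rfl⟩ := hspan hz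
    rw [map_add, LinearMap.add_apply, map_smul, LinearMap.smul_apply, hB.symm v, hxv,
      hJ hj' (r.lie_mem hvr), smul_zero, add_zero]
  -- `z` represents the functional `B v` on the radical, extended by zero to the Levi subalgebra
  let p := r.toSubmodule.projection s.toSubmodule hs.isCompl.symm
  have hp {y : L} (hy : y ∈ r) : p y = y :=
    Submodule.projection_apply_of_mem_left hs.isCompl.symm hy
  have hps {y : L} (hy : y ∈ s) : p y = 0 :=
    (Submodule.projection_apply_eq_zero_iff hs.isCompl.symm).mpr hy
  have hpr (y : L) : p y ∈ r := Submodule.projection_apply_mem hs.isCompl.symm y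
  have hsub (y : L) : y - p y ∈ s := Submodule.sub_projection_mem hs.isCompl.symm y
  obtain ⟨z, hz⟩ : ∃ z, ∀ y, B z y = B v (p y) :=
    ⟨(B.toDual hB.nondegenerate).symm (B v ∘ₗ p), fun y =>
      LinearMap.BilinForm.apply_toDual_symm_apply _ _⟩
  have hcentral (x : L) : ⁅x, z⁆ = 0 := by
    rw [← lie_skew, neg_eq_zero]
    refine hB.eq_zero fun y => ?_
    rw [hB.invariant, hz]
    have h₁ : ⁅x, y⁆ = ⁅x - p x, y - p y⁆ + (⁅x - p x, p y⁆ - ⁅y, p x⁆) := by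
      rw [← lie_skew y (p x), sub_neg_eq_add, ← add_assoc, ← lie_add, sub_add_cancel, ← add_lie,
        sub_add_cancel]
    have h₂ : ⁅x - p x, p y⁆ - ⁅y, p x⁆ ∈ J := J.sub_mem (hlie _ (hpr y)) (hlie _ (hpr x))
    rw [h₁, map_add p, hps (s.lie_mem (hsub x) (hsub y)), hp (hle h₂), zero_add, hB.symm,
      hJ h₂ hvr]
  have hzr : z ∈ r := by
    have h₁ : z - v ∈ J := by
      refine (mem_orthogonalIdeal hB).mpr fun y hy => ?_
      rw [hB.symm, map_sub, LinearMap.sub_apply, hz, hp hy, sub_self]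
    simpa using r.add_mem (hle h₁) hvr
  have hzz : B z z ≠ 0 := by
    rwa [hz, hp hzr, hB.symm, hz, hp hvr]
  let I : LieIdeal F L :=
    { F ∙ z with
      lie_mem := fun {x m} hm => by
        obtain ⟨c, rfl⟩ := Submodule.mem_span_singleton.mp hm
        rw [lie_smul, hcentral, smul_zero]
        exact (F ∙ z).zero_mem }
  have hzI : z ∈ I := Submodule.mem_span_singleton_self z
  have hI : (B.restrict I.toSubmodule).Nondegenerate := by
    have hrefl : (B.restrict I.toSubmodule).IsRefl := fun x y h => hB.isRefl _ _ h
    refine (LinearMap.IsRefl.nondegenerate_iff_separatingLeft hrefl).mpr fun x hx => ?_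
    obtain ⟨c, hc⟩ := Submodule.mem_span_singleton.mp x.2
    have h₁ : B (x : L) z = 0 := hx ⟨z, hzI⟩
    rw [← hc, map_smul, LinearMap.smul_apply, smul_eq_mul] at h₁
    rw [(mul_eq_zero.mp h₁).resolve_right hzz, zero_smul] at hc
    exact Subtype.ext hc.symm
  rcases hirr I hI with h | h
  · rw [h, LieSubmodule.mem_bot] at hzI
    rw [hzI, map_zero] at hzz
    exact hzz rfl
  · have hab : IsLieAbelian L := ⟨fun x y => by
      have hy : y ∈ I := h ▸ LieSubmodule.mem_top y
      obtain ⟨c, rfl⟩ := Submodule.mem_span_singleton.mp hy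
      rw [lie_smul, hcentral, smul_zero]⟩
    exact hsolv inferInstance

end QuadraticLie

/-! ### The Levi subalgebra and its action on the radical -/

theorem mainTheorem3 {F : Type*} [Field F] [CharZero F] [IsAlgClosed F]
    {L : Type*} [LieRing L] [LieAlgebra F L] [FiniteDimensional F L]
    (B : LinearMap.BilinForm F L) (hB : QuadraticLie.IsInvariantScalarProduct B)
    (hirr : QuadraticLie.IsIrreducibleForm B)
    (hsolv : ¬ LieAlgebra.IsSolvable L)
    (hsimple : ¬ LieAlgebra.IsSimple F L)
    (hdim : Module.finrank F L ≤ 13)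
    (s : LieSubalgebra F L) (hs : QuadraticLie.IsLeviSubalgebra F L s)
    (r : LieIdeal F L) (hr : r = LieAlgebra.radical F L)
    (hne : r ≠ QuadraticLie.orthogonalIdeal hB r) :
    Nonempty (s ≃ₗ⁅F⁆ SL2.sl2 F) ∧
    QuadraticLie.orthogonalIdeal hB r ≤ r ∧
    ∀ (e : s ≃ₗ⁅F⁆ SL2.sl2 F)
      (u : LieSubmodule F s (QuadraticLie.IdealQuotient r (QuadraticLie.orthogonalIdeal hB r))),
      LieModule.IsIrreducible F s u →
      ∃ n ∈ ({0, 1, 2, 4, 6} : Set ℕ), ∃ φ : u ≃ₗ[F] SL2.V F n,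
        ∀ (x : s) (m : u), φ ⁅x, m⁆ = ⁅e x, φ m⁆ := by
  subst hr
  have hle := QuadraticLie.orthogonalIdeal_radical_le hB hirr hsolv hsimple hs
  set r := LieAlgebra.radical F L
  set J := QuadraticLie.orthogonalIdeal hB r
  have hsum : Module.finrank F s + Module.finrank F r = Module.finrank F L :=
    Submodule.finrank_add_eq_of_isCompl hs.isCompl
  have hJ : Module.finrank F J = Module.finrank F L - Module.finrank F r :=
    QuadraticLie.finrank_orthogonalIdeal hB r
  have hlt : Module.finrank F J < Module.finrank F r :=
    Submodule.finrank_lt_finrank_of_lt <| lt_of_le_of_ne hle fun h =>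
      hne (LieSubmodule.toSubmodule_injective h).symm
  have hne_one : Module.finrank F r ≠ Module.finrank F J + 1 :=
    QuadraticLie.finrank_radical_ne_add_one hB hirr hsolv hs hle
  -- `2 dim s + dim r/r^⊥ ≤ 13`, and `r/r^⊥` has dimension at least two
  have hfive : Module.finrank F s ≤ 5 := by omega
  have hnontriv : Nontrivial s := by
    by_contra hs₀
    have hs₁ : Subsingleton s := not_nontrivial_iff_subsingleton.mp hs₀
    have h₁ : Module.finrank F s = 0 := Module.finrank_zero_of_subsingleton
    have h₂ : r.toSubmodule = ⊤ :=
      Submodule.eq_top_of_finrank_eq ((zero_add _).symm.trans (h₁ ▸ hsum))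
    have h₃ : r = ⊤ := LieSubmodule.toSubmodule_injective h₂
    have h₄ : LieAlgebra.IsSolvable (⊤ : LieIdeal F L) := h₃ ▸ LieAlgebra.radicalIsSolvable F L
    exact hsolv ((LieAlgebra.solvable_iff_equiv_solvable (R := F) LieSubalgebra.topEquiv).mp h₄)
  have hss := hs.semisimple
  obtain ⟨h, e, f, t, hspan⟩ := LieAlgebra.IsKilling.exists_isSl2Triple_spanning hfive
  have hiso := SL2.nonempty_lieEquiv_of_spanning t hspan
  refine ⟨hiso, hle, fun ε u hu => ?_⟩
  -- so `r/r^⊥` has dimension at most `13 - 2 · 3 = 7`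
  have hthree : Module.finrank F s = 3 := ε.toLinearEquiv.finrank_eq.trans SL2.finrank_sl2
  have hW : Module.finrank F (QuadraticLie.IdealQuotient r J) =
      Module.finrank F r - Module.finrank F J := by
    have h₁ : Module.finrank F (J.toSubmodule.submoduleOf r.toSubmodule) = Module.finrank F J :=
      (Submodule.submoduleOfEquivOfLe hle).finrank_eq
    rw [← h₁]
    exact Submodule.finrank_quotient _
  obtain ⟨Q, hQ, hQsymm, hQinv⟩ := QuadraticLie.exists_form_idealQuotient hB r
  have : Nontrivial u := LieModule.nontrivial_of_isIrreducible F s u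
  obtain ⟨μ, m, -, P⟩ :=
    (SL2.isSl2Triple_symm_apply ε).exists_hasPrimitiveVectorWith (R := F) (M := u)
  obtain ⟨n, rfl⟩ := P.exists_nat
  have hdimu : Module.finrank F u = n + 1 := by
    simpa using Module.finrank_eq_card_basis (P.basis n (SL2.symm_apply_spanning ε))
  have hule : Module.finrank F u ≤ Module.finrank F (QuadraticLie.IdealQuotient r J) :=
    Submodule.finrank_le u.toSubmodule
  have hodd : Odd n → 2 * (n + 1) ≤ Module.finrank F (QuadraticLie.IdealQuotient r J) :=
    P.two_mul_le_finrank (SL2.symm_apply_spanning ε) hQ (fun x y z => hQinv x y z) hQsymm u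
  refine ⟨n, ?_, SL2.exists_linearEquiv_V ε P⟩
  have hn : n ≤ 6 := by omega
  interval_cases n
  · simp
  · simp
  · simp
  · have := hodd (by decide)
    omega
  · simp
  · have := hodd (by decide)
    omega
  · simp
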